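/- Let $\gamma=(\gamma_{i,j})_{i,j\ge1}$ satisfy $0\le\gamma_{i,j}=\gamma_{j,i}$ and $\gamma_{i,j}\le A(i+j)$ for all $i,j\ge1$, where $A>0$ is a constant. Let $\xi^{\rm in}=(\xi_i^{\rm in})_{i\ge1}$ be a sequence of non-negative real numbers with $\sum_{i\ge1} i\,\xi_i^{\rm in}<\infty$. Let $\mathcal G_1$ be the set of non-negative convex functions $G\in C^1([0,\infty))\cap W^{2,\infty}_{\rm loc}(0,\infty)$ such that $G(0)=0$, $G'(0)\ge0$ and $G'$ is concave on $[0,\infty)$, and assume that for some $G\in\mathcal G_1$ $$\sum_{i=1}^\infty G(i)\,\xi_i^{\rm in}<\infty .$$ Then there is a sequence $\xi=(\xi_i)_{i\ge1}$ of non-negative continuous functions on $[0,\infty)$ that solves the discrete Safronov--Dubovski coagulation equation with initial datum $\xi^{\rm in}$ in the following sense: for each $i\ge1$ and $t>0$, the series $\sum_{j\ge i}\gamma_{i,j}\xi_i\xi_j$ converges almost everywhere in $(0,t)$, with sum in $L^1(0,t)$, and $$\xi_i(t)=\xi_i^{\rm in}+\int_0^t\Big[\xi_{i-1}(\tau)\sum_{j=1}^{i-1}j\gamma_{i-1,j}\xi_j(\tau)-\xi_i(\tau)\sum_{j=1}^{i}j\gamma_{i,j}\xi_j(\tau)-\sum_{j=i}^\infty\gamma_{i,j}\xi_i(\tau)\xi_j(\tau)\Big]\,d\tau$$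 (the first sum being empty for $i=1$), together with $\xi_i(0)=\xi_i^{\rm in}$; which conserves mass, $$\sum_{i=1}^\infty i\,\xi_i(t)=\sum_{i=1}^\infty i\,\xi_i^{\rm in}<\infty\qquad\text{for all } t\ge0;$$ and which satisfies, for each $T\in(0,\infty)$, $$\sup_{t\in[0,T]}\ \sum_{i=1}^\infty G(i)\,\xi_i(t)<\infty .$$ -/

import Mathlib

open Set MeasureTheory
open scoped ContDiff ENNReal

noncomputable section

/-! Sequences `(ξ_i)_{i ≥ 1}` are functions on `ℕ` of which only the entries with `i ≥ 1` matter: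
the entry at `0` is never constrained and contributes `0` to every sum below. -/

/-- The space `Ξ₁` of the sequences `(ξ_i)_{i ≥ 1}` with `∑_{i ≥ 1} i |ξ_i| < ∞`. -/
def MemXiOne (x : ℕ → ℝ) : Prop :=
  Summable fun i : ℕ => (i : ℝ) * |x i|

/-- The norm `∑_{i ≥ 1} i |ξ_i|` of `Ξ₁`. -/
def normXiOne (x : ℕ → ℝ) : ℝ :=
  ∑' i : ℕ, (i : ℝ) * |x i|

/-- The positive cone of `Ξ₁`. -/
def MemXiOnePos (x : ℕ → ℝ) : Prop :=
  MemXiOne x ∧ ∀ i : ℕ, 1 ≤ i → 0 ≤ x i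

/-- The function `f` belongs to `L^∞_loc(0,∞)`. -/
def MemLinftyLocPos (f : ℝ → ℝ) : Prop :=
  ∀ a b : ℝ, 0 < a → a < b → MemLp f ∞ (volume.restrict (Icc a b))

/-- The function `g` is the weak derivative of `f` on `(0,∞)`
(used for `f`, `g` in `L^∞_loc(0,∞)`). -/
def IsWeakDerivPos (f g : ℝ → ℝ) : Prop :=
  ∀ φ : ℝ → ℝ, ContDiff ℝ ∞ φ → HasCompactSupport φ → tsupport φ ⊆ Ioi 0 →
    ∫ x, f x * deriv φ x = -∫ x, g x * φ x

/-- The Sobolev space `W^{2,∞}_loc(0,∞)`. -/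
def MemW2InftyLocPos (f : ℝ → ℝ) : Prop :=
  ∃ f₁ f₂ : ℝ → ℝ, MemLinftyLocPos f ∧ MemLinftyLocPos f₁ ∧ MemLinftyLocPos f₂ ∧
    IsWeakDerivPos f f₁ ∧ IsWeakDerivPos f₁ f₂

/-- The class `𝒢₁`; only the values of `G` on `[0,∞)` matter, and `G'` is the derivative
relative to `[0,∞)` (one-sided at `0`). -/
structure MemGOne (G : ℝ → ℝ) : Prop where
  nonneg : ∀ x : ℝ, 0 ≤ x → 0 ≤ G x
  convex : ConvexOn ℝ (Ici 0) G
  contDiff : ContDiffOn ℝ 1 G (Ici 0)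
  sobolev : MemW2InftyLocPos G
  zero : G 0 = 0
  deriv_zero_nonneg : 0 ≤ derivWithin G (Ici 0) 0
  deriv_concave : ConcaveOn ℝ (Ici 0) (derivWithin G (Ici 0))

/-- The series `∑_{j ≥ i} γ_{i,j} x_i x_j`, with the summation index written as `j = i + k`. -/
def lossSeries (γ : ℕ → ℕ → ℝ) (x : ℕ → ℝ) (i : ℕ) : ℝ :=
  ∑' k : ℕ, γ i (i + k) * x i * x (i + k)

/-- The right-hand side of the discrete Safronov-Dubovski equation for clusters of size `i ≥ 1`.
The first sum is empty for `i = 1`. -/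
def safronovRHS (γ : ℕ → ℕ → ℝ) (x : ℕ → ℝ) (i : ℕ) : ℝ :=
  x (i - 1) * ∑ j ∈ Finset.Icc 1 (i - 1), (j : ℝ) * γ (i - 1) j * x j
    - x i * ∑ j ∈ Finset.Icc 1 i, (j : ℝ) * γ i j * x j
    - lossSeries γ x i

/-- Solutions on `[0,∞)` of the discrete Safronov-Dubovski equation with kernel `γ` and initial
datum `x0`. -/
structure IsSafronovSolution (γ : ℕ → ℕ → ℝ) (x0 : ℕ → ℝ) (ξ : ℕ → ℝ → ℝ) : Prop where
  nonneg : ∀ i : ℕ, 1 ≤ i → ∀ t : ℝ, 0 ≤ t → 0 ≤ ξ i t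
  continuousOn : ∀ i : ℕ, 1 ≤ i → ContinuousOn (ξ i) (Ici 0)
  /-- The series `∑_{j ≥ i} γ_{i,j} ξ_i ξ_j` converges almost everywhere in `(0,t)`. -/
  summable : ∀ i : ℕ, 1 ≤ i → ∀ t : ℝ, 0 < t →
    ∀ᵐ s ∂(volume.restrict (Ioo 0 t)), Summable fun k : ℕ => γ i (i + k) * ξ i s * ξ (i + k) s
  /-- Its sum belongs to `L¹(0,t)`. -/
  integrable : ∀ i : ℕ, 1 ≤ i → ∀ t : ℝ, 0 < t →
    IntegrableOn (fun s => lossSeries γ (fun n => ξ n s) i) (Ioo 0 t)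
  /-- The integrated equation; at `t = 0` it is the initial condition. -/
  equation : ∀ i : ℕ, 1 ≤ i → ∀ t : ℝ, 0 ≤ t →
    ξ i t = x0 i + ∫ s in (0 : ℝ)..t, safronovRHS γ (fun n => ξ n s) i

end

/-! Cut the kernel off at size `n`. The result is a finite polynomial ODE system whose solutions are
nonnegative and conserve mass exactly. With `M` the initial mass, each component stays in `[0, M]`
and is Lipschitz in time with a constant free of `n`, so a subsequence converges pointwise.
Everything else rests on one moment estimate. If a weight satisfies `i (φ (i+1) - φ i) ≤ C φ i`, the
weak formulation (`IsTruncKernel.sum_mul_truncRHS`) and the linear growth of the kernel give `S' ≤ 2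
A C M S` for `S = ∑ φ i x i`, hence an exponential bound uniform in `n`
(`IsTruncSolution.moment_le`). It is used twice. For `tailWeight N` (`C = 3`) it makes the tails of
the first moment uniformly small, so mass and the infinite loss series pass to the limit, with no
superlinear moment required. For `G` (`C = 8`, by `MemGOne.mul_sub_le`) it propagates the
`G`-moment. -/

/-! ### Truncated kernels and the moment inequality. -/

/-- The kernel `γ` restricted to sizes between `1` and `n - 1`. -/
noncomputable def truncKernel (γ : ℕ → ℕ → ℝ) (n i j : ℕ) : ℝ :=
  if 1 ≤ i ∧ i < n ∧ 1 ≤ j ∧ j < n then γ i j else 0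

/-- The rate at which clusters of size `i` turn into clusters of size `i + 1`. -/
noncomputable def growthRate (κ : ℕ → ℕ → ℝ) (y : ℕ → ℝ) (i : ℕ) : ℝ :=
  y i * ∑ j ∈ Finset.Icc 1 i, (j : ℝ) * κ i j * y j

/-- The right-hand side of the equation with the loss series cut at size `n`. -/
noncomputable def truncRHS (κ : ℕ → ℕ → ℝ) (n : ℕ) (y : ℕ → ℝ) (i : ℕ) : ℝ :=
  growthRate κ y (i - 1) - growthRate κ y i - ∑ j ∈ Finset.Icc i n, κ i j * y i * y j

/-- The properties of a truncated kernel that are used below. -/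
structure IsTruncKernel (κ : ℕ → ℕ → ℝ) (n : ℕ) (A : ℝ) : Prop where
  nonneg : ∀ i j, 0 ≤ κ i j
  symm : ∀ i j, κ i j = κ j i
  le : ∀ i j : ℕ, κ i j ≤ A * ((i : ℝ) + j)
  zero_left : ∀ j, κ 0 j = 0
  last_left : ∀ j, κ n j = 0

/-- The strict cut `i < n` makes size `n` inert: it can be reached from `n - 1` but never left, so
the sizes up to `n` form a closed system. -/
lemma isTruncKernel_truncKernel {γ : ℕ → ℕ → ℝ} {A : ℝ} (hA : 0 < A)
    (hγ_nonneg : ∀ i j : ℕ, 1 ≤ i → 1 ≤ j → 0 ≤ γ i j)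
    (hγ_symm : ∀ i j : ℕ, 1 ≤ i → 1 ≤ j → γ i j = γ j i)
    (hγ_growth : ∀ i j : ℕ, 1 ≤ i → 1 ≤ j → γ i j ≤ A * ((i : ℝ) + (j : ℝ))) (n : ℕ) :
    IsTruncKernel (truncKernel γ n) n A where
  nonneg i j := by
    unfold truncKernel
    split_ifs with h
    · exact hγ_nonneg i j h.1 h.2.2.1
    · exact le_rfl
  symm i j := by
    unfold truncKernel
    by_cases h : 1 ≤ i ∧ i < n ∧ 1 ≤ j ∧ j < n
    · rw [if_pos h, if_pos (by tauto), hγ_symm i j h.1 h.2.2.1]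
    · rw [if_neg h, if_neg (by tauto)]
  le i j := by
    unfold truncKernel
    split_ifs with h
    · exact hγ_growth i j h.1 h.2.2.1
    · positivity
  zero_left j := if_neg (by omega)
  last_left j := if_neg (by omega)

/-- The weak formulation of the truncated equation. -/
lemma IsTruncKernel.sum_mul_truncRHS {κ : ℕ → ℕ → ℝ} {n : ℕ} {A : ℝ} (hκ : IsTruncKernel κ n A)
    (y φ : ℕ → ℝ) :
    ∑ i ∈ Finset.range (n + 1), φ i * truncRHS κ n y i =
      ∑ i ∈ Finset.range (n + 1), ∑ j ∈ Finset.Icc 1 i,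
        κ i j * y i * y j * (j * (φ (i + 1) - φ i) - φ j) := by
  have h0 : growthRate κ y 0 = 0 := by simp [growthRate]
  have hn : growthRate κ y n = 0 := by simp [growthRate, hκ.last_left]
  -- Summation by parts: the boundary terms vanish because size `0` has an empty growth sum and size
  -- `n` is inert.
  have hshift : ∑ i ∈ Finset.range (n + 1), φ i * growthRate κ y (i - 1) =
      ∑ i ∈ Finset.range (n + 1), φ (i + 1) * growthRate κ y i := by
    rw [Finset.sum_range_succ', Finset.sum_range_succ (fun i => φ (i + 1) * growthRate κ y i), hn]
    simp [h0]
  have hloss : ∑ i ∈ Finset.range (n + 1), φ i * ∑ j ∈ Finset.Icc i n, κ i j * y i * y j =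
      ∑ i ∈ Finset.range (n + 1), ∑ j ∈ Finset.Icc 1 i, κ i j * y i * y j * φ j := by
    simp_rw [Finset.mul_sum]
    rw [Finset.sum_comm' (t' := Finset.range (n + 1)) (s' := fun j => Finset.Icc 0 j)
      (by intro i j; simp only [Finset.mem_range, Finset.mem_Icc]; omega)]
    refine Finset.sum_congr rfl fun i _ => ?_
    rw [← Finset.sum_subset (s₁ := Finset.Icc 1 i)]
    · refine Finset.sum_congr rfl fun j _ => ?_
      rw [hκ.symm j i]; ring
    · exact Finset.Icc_subset_Icc_left zero_le_one
    · intro j hj hj'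
      have : j = 0 := by simp only [Finset.mem_Icc] at hj hj'; omega
      simp [this, hκ.zero_left]
  have hexp : ∀ i, φ i * truncRHS κ n y i = φ i * growthRate κ y (i - 1)
      - φ i * growthRate κ y i - φ i * ∑ j ∈ Finset.Icc i n, κ i j * y i * y j := by
    intro i; unfold truncRHS; ring
  simp_rw [hexp, Finset.sum_sub_distrib]
  rw [hshift, hloss, ← Finset.sum_sub_distrib, ← Finset.sum_sub_distrib]
  refine Finset.sum_congr rfl fun i _ => ?_
  unfold growthRate
  simp_rw [Finset.mul_sum]
  rw [← Finset.sum_sub_distrib, ← Finset.sum_sub_distrib]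
  exact Finset.sum_congr rfl fun j _ => by ring

/-- For `φ i = i` the bracket `j (φ (i+1) - φ i) - φ j` is zero. Nothing is assumed on `y`, so this
also applies to clipped states. -/
lemma IsTruncKernel.sum_id_mul_truncRHS {κ : ℕ → ℕ → ℝ} {n : ℕ} {A : ℝ}
    (hκ : IsTruncKernel κ n A) (y : ℕ → ℝ) :
    ∑ i ∈ Finset.range (n + 1), (i : ℝ) * truncRHS κ n y i = 0 := by
  rw [hκ.sum_mul_truncRHS y (fun i => (i : ℝ))]
  exact Finset.sum_eq_zero fun i _ => Finset.sum_eq_zero fun j _ => by push_cast; ring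

/-- Growth estimate for the moments with slowly varying weights. -/
lemma IsTruncKernel.sum_mul_truncRHS_le {κ : ℕ → ℕ → ℝ} {n : ℕ} {A : ℝ} (hA : 0 ≤ A)
    (hκ : IsTruncKernel κ n A) {y φ : ℕ → ℝ} (hy : ∀ i, 0 ≤ y i) {C M : ℝ} (hC : 0 ≤ C)
    (hφ : ∀ i, 0 ≤ φ i) (hφC : ∀ i : ℕ, 1 ≤ i → i * (φ (i + 1) - φ i) ≤ C * φ i)
    (hM : ∑ i ∈ Finset.range (n + 1), (i : ℝ) * y i ≤ M) :
    ∑ i ∈ Finset.range (n + 1), φ i * truncRHS κ n y i ≤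
      2 * A * C * M * ∑ i ∈ Finset.range (n + 1), φ i * y i := by
  rw [hκ.sum_mul_truncRHS y φ, Finset.mul_sum]
  refine Finset.sum_le_sum fun i hi => ?_
  have hin : i < n + 1 := Finset.mem_range.1 hi
  have hterm : ∀ j ∈ Finset.Icc 1 i, κ i j * y i * y j * (j * (φ (i + 1) - φ i) - φ j) ≤
      2 * A * C * (φ i * y i) * (j * y j) := by
    intro j hj
    obtain ⟨hj1, hji⟩ := Finset.mem_Icc.1 hj
    have hi0 : (0 : ℝ) < i := by exact_mod_cast (by omega : 0 < i)
    have hji' : (j : ℝ) ≤ i := by exact_mod_cast hji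
    have h1 : j * (φ (i + 1) - φ i) - φ j ≤ j * (C * φ i / i) := by
      have : φ (i + 1) - φ i ≤ C * φ i / i := by
        rw [le_div_iff₀ hi0, mul_comm]; exact hφC i (by omega)
      nlinarith [hφ j, mul_le_mul_of_nonneg_left this (Nat.cast_nonneg (α := ℝ) j)]
    -- As `j ≤ i`, the kernel costs only a factor `i`, which the `1 / i` from the weight condition
    -- cancels; the remaining `j y j` sums to the mass.
    have h2 : κ i j ≤ 2 * A * i := by
      refine (hκ.le i j).trans ?_
      nlinarith
    have hyy : 0 ≤ y i * y j := mul_nonneg (hy i) (hy j)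
    have h3 : 0 ≤ j * (C * φ i / i) := by have := hφ i; positivity
    calc κ i j * y i * y j * (j * (φ (i + 1) - φ i) - φ j)
        ≤ κ i j * y i * y j * (j * (C * φ i / i)) := by
          refine mul_le_mul_of_nonneg_left h1 ?_
          rw [mul_assoc]; exact mul_nonneg (hκ.nonneg i j) hyy
      _ = κ i j * ((y i * y j) * (j * (C * φ i / i))) := by ring
      _ ≤ 2 * A * i * ((y i * y j) * (j * (C * φ i / i))) :=
          mul_le_mul_of_nonneg_right h2 (mul_nonneg hyy h3)
      _ = 2 * A * C * (φ i * y i) * (j * y j) := by field_simp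
  refine (Finset.sum_le_sum hterm).trans ?_
  rw [← Finset.mul_sum]
  have hsub : ∑ j ∈ Finset.Icc 1 i, (j : ℝ) * y j ≤ M := by
    refine le_trans (Finset.sum_le_sum_of_subset_of_nonneg ?_ ?_) hM
    · intro j hj
      rw [Finset.mem_Icc] at hj
      rw [Finset.mem_range]; omega
    · intro j _ _; exact mul_nonneg (Nat.cast_nonneg _) (hy j)
  have : 0 ≤ 2 * A * C * (φ i * y i) := by have := hφ i; have := hy i; positivity
  calc _ ≤ 2 * A * C * (φ i * y i) * M := mul_le_mul_of_nonneg_left hsub this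
    _ = _ := by ring


/-! ### Bounds on the truncated right-hand side, uniform in the truncation. -/

lemma IsTruncKernel.growthRate_nonneg {κ : ℕ → ℕ → ℝ} {n : ℕ} {A : ℝ}
    (hκ : IsTruncKernel κ n A) {y : ℕ → ℝ} (hy : ∀ i, 0 ≤ y i) (i : ℕ) :
    0 ≤ growthRate κ y i :=
  mul_nonneg (hy i) (Finset.sum_nonneg fun j _ =>
    mul_nonneg (mul_nonneg (Nat.cast_nonneg _) (hκ.nonneg i j)) (hy j))

lemma IsTruncKernel.growthRate_le {κ : ℕ → ℕ → ℝ} {n : ℕ} {A : ℝ} (hA : 0 ≤ A)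
    (hκ : IsTruncKernel κ n A) {y : ℕ → ℝ} (hy : ∀ i, 0 ≤ y i) {M : ℝ}
    (hM : ∑ i ∈ Finset.range (n + 1), (i : ℝ) * y i ≤ M) (hyM : ∀ i, y i ≤ M)
    {i : ℕ} (hi : i ≤ n) : growthRate κ y i ≤ 2 * A * i * M ^ 2 := by
  have hM0 : 0 ≤ M := (hy 0).trans (hyM 0)
  have hsum : ∑ j ∈ Finset.Icc 1 i, (j : ℝ) * κ i j * y j ≤ 2 * A * i * M := by
    calc ∑ j ∈ Finset.Icc 1 i, (j : ℝ) * κ i j * y j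
        ≤ ∑ j ∈ Finset.Icc 1 i, 2 * A * i * (j * y j) := by
          refine Finset.sum_le_sum fun j hj => ?_
          have hji : (j : ℝ) ≤ i := by exact_mod_cast (Finset.mem_Icc.1 hj).2
          have h2 : κ i j ≤ 2 * A * i := (hκ.le i j).trans (by nlinarith)
          calc (j : ℝ) * κ i j * y j = κ i j * (j * y j) := by ring
            _ ≤ _ := mul_le_mul_of_nonneg_right h2 (mul_nonneg (Nat.cast_nonneg _) (hy j))
      _ = 2 * A * i * ∑ j ∈ Finset.Icc 1 i, (j * y j) := by rw [Finset.mul_sum]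
      _ ≤ 2 * A * i * M := by
          refine mul_le_mul_of_nonneg_left ?_ (by positivity)
          refine le_trans (Finset.sum_le_sum_of_subset_of_nonneg ?_ ?_) hM
          · intro j hj
            rw [Finset.mem_Icc] at hj
            rw [Finset.mem_range]; omega
          · intro j _ _; exact mul_nonneg (Nat.cast_nonneg _) (hy j)
  calc growthRate κ y i ≤ M * (2 * A * i * M) :=
        mul_le_mul (hyM i) hsum (Finset.sum_nonneg fun j _ =>
          mul_nonneg (mul_nonneg (Nat.cast_nonneg _) (hκ.nonneg i j)) (hy j)) hM0
    _ = _ := by ring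

lemma IsTruncKernel.loss_nonneg {κ : ℕ → ℕ → ℝ} {n : ℕ} {A : ℝ}
    (hκ : IsTruncKernel κ n A) {y : ℕ → ℝ} (hy : ∀ i, 0 ≤ y i) (i : ℕ) :
    0 ≤ ∑ j ∈ Finset.Icc i n, κ i j * y i * y j :=
  Finset.sum_nonneg fun j _ => mul_nonneg (mul_nonneg (hκ.nonneg i j) (hy i)) (hy j)

/-- Here `j ≥ i`, so the kernel is at most `2 A j` and the sum is absorbed by the first moment. -/
lemma IsTruncKernel.loss_le {κ : ℕ → ℕ → ℝ} {n : ℕ} {A : ℝ} (hA : 0 ≤ A)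
    (hκ : IsTruncKernel κ n A) {y : ℕ → ℝ} (hy : ∀ i, 0 ≤ y i) {M : ℝ}
    (hM : ∑ i ∈ Finset.range (n + 1), (i : ℝ) * y i ≤ M) (hyM : ∀ i, y i ≤ M) (i : ℕ) :
    ∑ j ∈ Finset.Icc i n, κ i j * y i * y j ≤ 2 * A * M ^ 2 := by
  have hM0 : 0 ≤ M := (hy 0).trans (hyM 0)
  calc ∑ j ∈ Finset.Icc i n, κ i j * y i * y j
      ≤ ∑ j ∈ Finset.Icc i n, 2 * A * M * (j * y j) := by
        refine Finset.sum_le_sum fun j hj => ?_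
        have hji : (i : ℝ) ≤ j := by exact_mod_cast (Finset.mem_Icc.1 hj).1
        have h2 : κ i j ≤ 2 * A * j := (hκ.le i j).trans (by nlinarith)
        calc κ i j * y i * y j ≤ 2 * A * j * M * y j :=
              mul_le_mul_of_nonneg_right (mul_le_mul h2 (hyM i) (hy i) (by positivity)) (hy j)
          _ = _ := by ring
    _ = 2 * A * M * ∑ j ∈ Finset.Icc i n, (j * y j) := by rw [Finset.mul_sum]
    _ ≤ 2 * A * M * M := by
        refine mul_le_mul_of_nonneg_left ?_ (by positivity)
        refine le_trans (Finset.sum_le_sum_of_subset_of_nonneg ?_ ?_) hM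
        · intro j hj
          rw [Finset.mem_Icc] at hj
          rw [Finset.mem_range]; omega
        · intro j _ _; exact mul_nonneg (Nat.cast_nonneg _) (hy j)
    _ = _ := by ring

lemma IsTruncKernel.abs_truncRHS_le {κ : ℕ → ℕ → ℝ} {n : ℕ} {A : ℝ} (hA : 0 ≤ A)
    (hκ : IsTruncKernel κ n A) {y : ℕ → ℝ} (hy : ∀ i, 0 ≤ y i) {M : ℝ}
    (hM : ∑ i ∈ Finset.range (n + 1), (i : ℝ) * y i ≤ M) (hyM : ∀ i, y i ≤ M)
    {i : ℕ} (hi : i ≤ n) : |truncRHS κ n y i| ≤ 2 * A * (i + 1) * M ^ 2 := by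
  have h1 := hκ.growthRate_nonneg hy i
  have h2 := hκ.growthRate_nonneg hy (i - 1)
  have h3 := hκ.growthRate_le hA hy hM hyM hi
  have h4 := hκ.growthRate_le hA hy hM hyM ((Nat.sub_le i 1).trans hi)
  have h5 := hκ.loss_nonneg hy i
  have h6 := hκ.loss_le hA hy hM hyM i
  have h7 : 2 * A * ((i - 1 : ℕ) : ℝ) * M ^ 2 ≤ 2 * A * i * M ^ 2 := by
    have : ((i - 1 : ℕ) : ℝ) ≤ i := by exact_mod_cast Nat.sub_le i 1
    gcongr
  have h8 : 0 ≤ 2 * A * M ^ 2 := by positivity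
  unfold truncRHS
  rw [abs_le]
  constructor <;> linarith

/-! ### Solvability of the truncated system. -/

/-- A function that increases whenever it is negative remains nonnegative. -/
lemma nonneg_of_deriv_nonneg_of_neg {T : ℝ} {u u' : ℝ → ℝ}
    (hu : ∀ t ∈ Icc 0 T, HasDerivWithinAt u (u' t) (Icc 0 T) t) (h0 : 0 ≤ u 0)
    (hneg : ∀ t ∈ Icc 0 T, u t < 0 → 0 ≤ u' t) : ∀ t ∈ Icc 0 T, 0 ≤ u t := by
  intro t ht
  by_contra! hlt
  have hc : ContinuousOn u (Icc 0 T) := fun s hs => (hu s hs).continuousWithinAt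
  have hsub : Icc 0 t ⊆ Icc 0 T := Icc_subset_Icc_right ht.2
  have hcomp : IsCompact (Icc 0 t ∩ u ⁻¹' Ici 0) :=
    isCompact_Icc.of_isClosed_subset
      ((hc.mono hsub).preimage_isClosed_of_isClosed isClosed_Icc isClosed_Ici) inter_subset_left
  -- `s` is the last time before `t` with `u ≥ 0`; after it `u` is negative, hence nondecreasing,
  -- which contradicts `u t < 0`.
  obtain ⟨s, ⟨hs, hus⟩, hmax⟩ := hcomp.exists_isGreatest ⟨0, ⟨le_rfl, ht.1⟩, h0⟩
  have hst : Icc s t ⊆ Icc 0 T := (Icc_subset_Icc_left hs.1).trans hsub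
  have hmono : MonotoneOn u (Icc s t) := by
    refine monotoneOn_of_hasDerivWithinAt_nonneg (convex_Icc s t) (hc.mono hst) (f' := u')
      (fun r hr => (hu r (hst (interior_subset hr))).mono (interior_subset.trans hst)) ?_
    intro r hr
    have hr' := interior_subset hr
    rw [interior_Icc] at hr
    refine hneg r (hst hr') ?_
    by_contra! hur
    exact absurd (hmax ⟨⟨hs.1.trans hr'.1, hr'.2⟩, hur⟩) (not_le.2 hr.1)
  have := hmono ⟨le_rfl, hs.2⟩ ⟨hs.2, le_rfl⟩ hs.2
  exact absurd hlt (not_lt.2 (le_trans hus this))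

/-- An autonomous bounded Lipschitz vector field has solutions on any interval `[0, T]`. -/
lemma exists_solution_of_bounded_lipschitz {E : Type*} [NormedAddCommGroup E] [NormedSpace ℝ E]
    [CompleteSpace E] {f : E → E} {K L : NNReal} (hf : LipschitzWith K f) (hL : ∀ v, ‖f v‖ ≤ L)
    (v₀ : E) {T : ℝ} (hT : 0 ≤ T) :
    ∃ α : ℝ → E, α 0 = v₀ ∧ ∀ t ∈ Icc 0 T, HasDerivWithinAt α (f (α t)) (Icc 0 T) t := by
  -- In a ball of radius `L T` the speed bound `L` prevents escape before time `T`.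
  have hP : IsPicardLindelof (fun _ => f) (⟨0, le_rfl, hT⟩ : Icc (0 : ℝ) T) v₀
      (L * T.toNNReal) 0 L K :=
    { lipschitzOnWith := fun _ _ => hf.lipschitzOnWith
      continuousOn := fun _ _ => continuousOn_const
      norm_le := fun _ _ v _ => hL v
      mul_max_le := by simp [hT] }
  exact hP.exists_eq_forall_mem_Icc_hasDerivWithinAt₀

/-- Extension of a finite vector by zero. -/
noncomputable def zeroExtend (n : ℕ) (v : Fin (n + 1) → ℝ) (i : ℕ) : ℝ :=
  if h : i < n + 1 then v ⟨i, h⟩ else 0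

lemma contDiff_zeroExtend (n i : ℕ) : ContDiff ℝ 1 fun v => zeroExtend n v i := by
  unfold zeroExtend
  split_ifs with h
  · exact contDiff_apply ℝ ℝ _
  · exact contDiff_const

/-- The coordinatewise projection onto `[0, M]`. -/
noncomputable def clipVec {ι : Type*} (M : ℝ) (v : ι → ℝ) (i : ι) : ℝ := max 0 (min M (v i))

lemma lipschitzWith_clipVec {ι : Type*} [Fintype ι] (M : ℝ) :
    LipschitzWith 1 (clipVec M : (ι → ℝ) → ι → ℝ) := by
  refine LipschitzWith.of_dist_le_mul fun v w => ?_
  rw [NNReal.coe_one, one_mul]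
  refine (dist_pi_le_iff dist_nonneg).2 fun i => le_trans ?_ (dist_le_pi_dist v w i)
  have h : LipschitzWith 1 (fun x : ℝ => max 0 (min M x)) :=
    ((LipschitzWith.id.const_min M).const_max 0)
  simpa [clipVec] using h.dist_le_mul (v i) (w i)

/-- The polynomial field is only locally Lipschitz; composed with the projection onto the box `[0,
M]^(n+1)` it becomes bounded and globally Lipschitz. -/
lemma exists_clipped_solution {κ : ℕ → ℕ → ℝ} {n : ℕ} (M : ℝ) (hM : 0 ≤ M)
    (v₀ : Fin (n + 1) → ℝ) {T : ℝ} (hT : 0 ≤ T) :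
    ∃ α : ℝ → Fin (n + 1) → ℝ, α 0 = v₀ ∧ ∀ t ∈ Icc 0 T, HasDerivWithinAt α
      (fun i => truncRHS κ n (zeroExtend n (clipVec M (α t))) i) (Icc 0 T) t := by
  have hext := contDiff_zeroExtend n
  have hg : ContDiff ℝ 1
      fun (v : Fin (n + 1) → ℝ) (i : Fin (n + 1)) => truncRHS κ n (zeroExtend n v) i := by
    refine contDiff_pi.2 fun i => ?_
    unfold truncRHS growthRate
    fun_prop
  set g := fun (v : Fin (n + 1) → ℝ) (i : Fin (n + 1)) => truncRHS κ n (zeroExtend n v) i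
  have hbox : IsCompact (Set.pi univ fun _ : Fin (n + 1) => Icc 0 M) :=
    isCompact_univ_pi fun _ => isCompact_Icc
  have hmaps : ∀ v : Fin (n + 1) → ℝ, clipVec M v ∈ Set.pi univ fun _ : Fin (n + 1) => Icc 0 M :=
    fun v i _ => ⟨le_max_left _ _, max_le hM (min_le_left _ _)⟩
  obtain ⟨K, hK⟩ :=
    (hg.locallyLipschitz.locallyLipschitzOn (s := Set.pi univ fun _ : Fin (n + 1) => Icc 0 M)
      ).exists_lipschitzOnWith_of_compact hbox
  obtain ⟨L, hL⟩ := hbox.exists_bound_of_continuousOn hg.continuous.continuousOn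
  have hlip : LipschitzWith (K * 1) fun v => g (clipVec M v) := by
    rw [← lipschitzOnWith_univ]
    exact hK.comp (lipschitzWith_clipVec M).lipschitzOnWith fun v _ => hmaps v
  exact exists_solution_of_bounded_lipschitz (L := L.toNNReal) hlip
    (fun v => (hL _ (hmaps v)).trans (Real.le_coe_toNNReal L)) v₀ hT

lemma le_sum_id_mul {y : ℕ → ℝ} (hy : ∀ i, 0 ≤ y i) {i N : ℕ} (hi : 1 ≤ i) (hiN : i < N) :
    y i ≤ ∑ j ∈ Finset.range N, (j : ℝ) * y j := by
  have h1 : (1 : ℝ) ≤ i := by exact_mod_cast hi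
  exact (le_mul_of_one_le_left (hy i) h1).trans (Finset.single_le_sum
    (f := fun j : ℕ => (j : ℝ) * y j)
    (fun j _ => mul_nonneg (Nat.cast_nonneg _) (hy j)) (Finset.mem_range.2 hiN))

/-- Solutions of the truncated equation on `[0, T]` that vanish outside the sizes `1, …, n`. -/
structure IsTruncSolution (κ : ℕ → ℕ → ℝ) (n : ℕ) (x0 : ℕ → ℝ) (T : ℝ) (x : ℕ → ℝ → ℝ) :
    Prop where
  init : ∀ i, x i 0 = if 1 ≤ i ∧ i ≤ n then x0 i else 0
  eq_zero : ∀ i, n < i → ∀ t, x i t = 0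
  nonneg : ∀ i, ∀ t ∈ Icc 0 T, 0 ≤ x i t
  mass : ∀ t ∈ Icc 0 T, ∑ i ∈ Finset.range (n + 1), (i : ℝ) * x i t =
    ∑ i ∈ Finset.range (n + 1), (i : ℝ) * x0 i
  zero_eq : ∀ t ∈ Icc 0 T, x 0 t = 0
  deriv : ∀ i ≤ n, ∀ t ∈ Icc 0 T,
    HasDerivWithinAt (x i) (truncRHS κ n (fun j => x j t) i) (Icc 0 T) t

/-- Solve the clipped system with `M` the initial mass; positivity and mass conservation confine its
solution to the box, where clipping does nothing. -/
lemma IsTruncKernel.exists_isTruncSolution {κ : ℕ → ℕ → ℝ} {n : ℕ} {A : ℝ}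
    (hκ : IsTruncKernel κ n A) {x0 : ℕ → ℝ} (hx0 : ∀ i, 1 ≤ i → 0 ≤ x0 i) {T : ℝ} (hT : 0 ≤ T) :
    ∃ x, IsTruncSolution κ n x0 T x := by
  set M : ℝ := ∑ i ∈ Finset.range (n + 1), (i : ℝ) * x0 i with hMdef
  have hterm : ∀ i : ℕ, 0 ≤ (i : ℝ) * x0 i := fun i => by
    rcases Nat.eq_zero_or_pos i with rfl | hi
    · simp
    · exact mul_nonneg (Nat.cast_nonneg _) (hx0 i hi)
  have hM : 0 ≤ M := Finset.sum_nonneg fun i _ => hterm i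
  set v₀ : Fin (n + 1) → ℝ := fun i => if 1 ≤ (i : ℕ) ∧ (i : ℕ) ≤ n then x0 i else 0
  obtain ⟨α, hα0, hα⟩ := exists_clipped_solution (κ := κ) M hM v₀ hT
  set x : ℕ → ℝ → ℝ := fun i t => zeroExtend n (α t) i with hx
  set y : ℝ → ℕ → ℝ := fun t => zeroExtend n (clipVec M (α t)) with hy
  have hxy : ∀ i t, y t i = if i < n + 1 then max 0 (min M (x i t)) else 0 := by
    intro i t
    simp only [hx, hy, zeroExtend, clipVec]
    split_ifs <;> rfl
  have hy0 : ∀ t i, 0 ≤ y t i := by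
    intro t i
    rw [hxy]
    split_ifs
    · exact le_max_left _ _
    · exact le_rfl
  have houtside : ∀ i, n < i → ∀ t, x i t = 0 := fun i hi t => dif_neg (by omega)
  have hinit : ∀ i, x i 0 = if 1 ≤ i ∧ i ≤ n then x0 i else 0 := by
    intro i
    by_cases h : i < n + 1
    · simp only [hx, zeroExtend, hα0, v₀, dif_pos h]
    · rw [houtside i (by omega), if_neg (by omega)]
  have hder : ∀ i ≤ n, ∀ t ∈ Icc 0 T,
      HasDerivWithinAt (x i) (truncRHS κ n (y t) i) (Icc 0 T) t := by
    intro i hi t ht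
    have hi' : i < n + 1 := by omega
    have := hasDerivWithinAt_pi.1 (hα t ht) ⟨i, hi'⟩
    simpa only [hx, zeroExtend, hi', dif_pos] using this
  have hnonneg : ∀ i, ∀ t ∈ Icc 0 T, 0 ≤ x i t := by
    intro i
    by_cases hi : i ≤ n
    · refine nonneg_of_deriv_nonneg_of_neg (hder i hi) ?_ ?_
      · rw [hinit]
        split_ifs with h
        · exact hx0 i h.1
        · exact le_rfl
      · intro t _ hneg
        -- A negative component is clipped to zero, which kills its loss terms and leaves only the
        -- nonnegative gain.
        have hyi : y t i = 0 := by
          rw [hxy, if_pos (by omega)]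
          exact max_eq_left ((min_le_right _ _).trans hneg.le)
        have h1 := hκ.growthRate_nonneg (hy0 t) (i - 1)
        simpa [truncRHS, hyi, growthRate] using h1
    · intro t _
      rw [houtside i (by omega)]
  -- Size `0` has weight zero in the mass, so it needs a separate argument to be kept in the box.
  have hzero : ∀ t ∈ Icc 0 T, x 0 t = 0 := by
    intro t ht
    have h := constant_of_derivWithin_zero (f := x 0) (a := 0) (b := T)
      (fun s hs => (hder 0 (Nat.zero_le _) s hs).differentiableWithinAt) (fun s hs => by
        have hTpos : 0 < T := hs.1.trans_lt hs.2
        rw [(hder 0 (Nat.zero_le _) s (Ico_subset_Icc_self hs)).derivWithin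
          (uniqueDiffOn_Icc hTpos s (Ico_subset_Icc_self hs))]
        simp [truncRHS, growthRate, hκ.zero_left]) t ht
    rw [h, hinit]
    simp
  -- The clipped field already conserves the unclipped mass, so no circularity arises.
  have hmass : ∀ t ∈ Icc 0 T, ∑ i ∈ Finset.range (n + 1), (i : ℝ) * x i t = M := by
    have hd : ∀ s ∈ Icc 0 T, HasDerivWithinAt
        (fun t => ∑ i ∈ Finset.range (n + 1), (i : ℝ) * x i t) 0 (Icc 0 T) s := by
      intro s hs
      have h0 := hκ.sum_id_mul_truncRHS (y s)
      refine HasDerivWithinAt.congr_deriv ?_ h0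
      exact HasDerivWithinAt.fun_sum fun i hi =>
        (hder i (Nat.lt_succ_iff.1 (Finset.mem_range.1 hi)) s hs).const_mul _
    intro t ht
    have h := constant_of_derivWithin_zero (a := 0) (b := T)
      (fun s hs => (hd s hs).differentiableWithinAt) (fun s hs => by
        have hTpos : 0 < T := hs.1.trans_lt hs.2
        exact (hd s (Ico_subset_Icc_self hs)).derivWithin
          (uniqueDiffOn_Icc hTpos s (Ico_subset_Icc_self hs))) t ht
    rw [h, hMdef]
    refine Finset.sum_congr rfl fun i hi => ?_
    rw [hinit]
    rcases Nat.eq_zero_or_pos i with rfl | hi0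
    · simp
    · rw [if_pos ⟨hi0, Nat.lt_succ_iff.1 (Finset.mem_range.1 hi)⟩]
  have hyx : ∀ t ∈ Icc 0 T, y t = fun j => x j t := by
    intro t ht
    funext i
    rw [hxy]
    split_ifs with h
    · have hle : x i t ≤ M := by
        rcases Nat.eq_zero_or_pos i with rfl | hi0
        · rw [hzero t ht]; exact hM
        · rw [← hmass t ht]
          exact le_sum_id_mul (fun j => hnonneg j t ht) hi0 h
      rw [min_eq_right hle, max_eq_right (hnonneg i t ht)]
    · exact (houtside i (by omega) t).symm
  exact ⟨x, hinit, houtside, hnonneg, hmass, hzero, fun i hi t ht => by rw [← hyx t ht]; exact hder i hi t ht⟩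

/-! ### Estimates along truncated solutions. -/

lemma IsTruncSolution.le_mass {κ : ℕ → ℕ → ℝ} {n : ℕ} {x0 : ℕ → ℝ} {T : ℝ} {x : ℕ → ℝ → ℝ}
    (hx : IsTruncSolution κ n x0 T x) {M : ℝ}
    (hM : ∑ i ∈ Finset.range (n + 1), (i : ℝ) * x0 i ≤ M) (hM0 : 0 ≤ M) (i : ℕ)
    {t : ℝ} (ht : t ∈ Icc 0 T) : x i t ≤ M := by
  by_cases h : i < n + 1
  · rcases Nat.eq_zero_or_pos i with rfl | hi0
    · rw [hx.zero_eq t ht]; exact hM0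
    · refine le_trans ?_ hM
      rw [← hx.mass t ht]
      exact le_sum_id_mul (fun j => hx.nonneg j t ht) hi0 h
  · rw [hx.eq_zero i (by omega)]; exact hM0

/-- Moments with slowly varying weights grow at most exponentially. -/
lemma IsTruncSolution.moment_le {κ : ℕ → ℕ → ℝ} {n : ℕ} {A : ℝ} (hA : 0 ≤ A)
    (hκ : IsTruncKernel κ n A) {x0 : ℕ → ℝ} {T : ℝ} {x : ℕ → ℝ → ℝ}
    (hx : IsTruncSolution κ n x0 T x) {M : ℝ}
    (hM : ∑ i ∈ Finset.range (n + 1), (i : ℝ) * x0 i ≤ M)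
    {φ : ℕ → ℝ} {C : ℝ} (hC : 0 ≤ C) (hφ : ∀ i, 0 ≤ φ i)
    (hφC : ∀ i : ℕ, 1 ≤ i → i * (φ (i + 1) - φ i) ≤ C * φ i)
    {t : ℝ} (ht : t ∈ Icc 0 T) :
    ∑ i ∈ Finset.range (n + 1), φ i * x i t ≤
      Real.exp (2 * A * C * M * t) * ∑ i ∈ Finset.range (n + 1), φ i * x i 0 := by
  set K := 2 * A * C * M
  set S : ℝ → ℝ := fun t => ∑ i ∈ Finset.range (n + 1), φ i * x i t
  have hS : ∀ s ∈ Icc 0 T, HasDerivWithinAt S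
      (∑ i ∈ Finset.range (n + 1), φ i * truncRHS κ n (fun j => x j s) i) (Icc 0 T) s := fun s hs =>
    HasDerivWithinAt.fun_sum fun i hi =>
      (hx.deriv i (Nat.lt_succ_iff.1 (Finset.mem_range.1 hi)) s hs).const_mul _
  -- Grönwall by integrating factor: `exp (-K s) S s` is nonincreasing.
  have hE : ∀ s ∈ Icc 0 T, HasDerivWithinAt (fun s => Real.exp (-(K * s)) * S s)
      (Real.exp (-(K * s)) * -K * S s + Real.exp (-(K * s)) *
        ∑ i ∈ Finset.range (n + 1), φ i * truncRHS κ n (fun j => x j s) i) (Icc 0 T) s := by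
    intro s hs
    have h1 : HasDerivAt (fun s : ℝ => Real.exp (-(K * s))) (Real.exp (-(K * s)) * -K) s := by
      have := ((hasDerivAt_id s).const_mul K).neg.exp
      simpa using this
    exact h1.hasDerivWithinAt.mul (hS s hs)
  have hanti : AntitoneOn (fun s => Real.exp (-(K * s)) * S s) (Icc 0 T) := by
    refine antitoneOn_of_hasDerivWithinAt_nonpos (convex_Icc 0 T)
      (fun s hs => (hE s hs).continuousWithinAt)
      (fun s hs => (hE s (interior_subset hs)).mono interior_subset) fun s hs => ?_
    have hs' := interior_subset hs
    have h := hκ.sum_mul_truncRHS_le hA (fun i => hx.nonneg i s hs') hC hφ hφC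
      ((hx.mass s hs').le.trans hM)
    have hpos := Real.exp_pos (-(K * s))
    have := mul_le_mul_of_nonneg_left h hpos.le
    simp only [S, K] at this ⊢
    linarith
  have h := hanti ⟨le_rfl, ht.1.trans ht.2⟩ ht ht.1
  simp only [mul_zero, neg_zero, Real.exp_zero, one_mul] at h
  have hpos := Real.exp_pos (K * t)
  calc S t = Real.exp (K * t) * (Real.exp (-(K * t)) * S t) := by
        rw [← mul_assoc, ← Real.exp_add]; simp
    _ ≤ _ := mul_le_mul_of_nonneg_left h hpos.le

/-! ### Slowly varying weights. -/

open Filter Topology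

/-- The weights given by a function of the class `𝒢₁` vary slowly. -/
lemma MemGOne.mul_sub_le {G : ℝ → ℝ} (hG : MemGOne G) {i : ℕ} (hi : 1 ≤ i) :
    i * (G ((i + 1 : ℕ) : ℝ) - G i) ≤ 8 * G i := by
  -- With `g = G'`: convexity gives `G (i+1) - G i ≤ g (i+1)`, concavity of `g` with `g 0 ≥ 0` gives
  -- `i g (i+1) ≤ (i+1) g i`, and comparing at `i / 2` gives `i g i ≤ 4 G i`. Since `i + 1 ≤ 2 i`,
  -- the constant is `8`.
  set g := derivWithin G (Ici 0)
  have hdiff : ∀ x ∈ Ici (0 : ℝ), DifferentiableWithinAt ℝ G (Ici 0) x :=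
    hG.contDiff.differentiableOn one_ne_zero
  obtain ⟨-, hconc⟩ := hG.deriv_concave
  have hi1 : (1 : ℝ) ≤ i := by exact_mod_cast hi
  have hi0 : (0 : ℝ) < i := by linarith
  have h1 : G ((i + 1 : ℕ) : ℝ) - G i ≤ g (i + 1) := by
    have := hG.convex.slope_le_derivWithin (x := i) (y := i + 1) (mem_Ici.2 hi0.le)
      (mem_Ici.2 (by linarith)) (by linarith) (hdiff _ (mem_Ici.2 (by linarith)))
    simpa [slope_def_field] using this
  have h2 : i / (i + 1) * g (i + 1) ≤ g i := by
    have := hconc (show (i : ℝ) + 1 ∈ Ici 0 from mem_Ici.2 (by linarith)) (mem_Ici.2 le_rfl)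
      (show (0 : ℝ) ≤ i / (i + 1) by positivity) (show (0 : ℝ) ≤ 1 / (i + 1) by positivity)
      (by field_simp)
    simp only [smul_eq_mul, mul_zero, add_zero] at this
    rw [div_mul_cancel₀ _ (by positivity)] at this
    have h0 : 0 ≤ 1 / ((i : ℝ) + 1) * g 0 := mul_nonneg (by positivity) hG.deriv_zero_nonneg
    linarith
  have h3 : g i / 2 ≤ g (i / 2) := by
    have := hconc (mem_Ici.2 hi0.le) (mem_Ici.2 le_rfl)
      (show (0 : ℝ) ≤ 1 / 2 by norm_num) (show (0 : ℝ) ≤ 1 / 2 by norm_num) (by norm_num)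
    simp only [smul_eq_mul, mul_zero, add_zero] at this
    rw [one_div_mul_eq_div, one_div_mul_eq_div, one_div_mul_eq_div] at this
    have h0 : 0 ≤ g 0 := hG.deriv_zero_nonneg
    linarith
  have h4 : g (i / 2) * (i / 2) ≤ G i := by
    have := hG.convex.derivWithin_le_slope (x := i / 2) (y := i) (mem_Ici.2 (by positivity))
      (mem_Ici.2 hi0.le) (by linarith) (hdiff _ (mem_Ici.2 (by positivity)))
    rw [slope_def_field, le_div_iff₀ (by linarith)] at this
    have hn := hG.nonneg (i / 2) (by positivity)
    have hsub : (i : ℝ) - i / 2 = i / 2 := by ring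
    rw [hsub] at this
    change g (i / 2) * (i / 2) ≤ _ at this
    linarith
  have h5 : i * g i ≤ 4 * G i := by nlinarith
  have h6 : i * g (i + 1) ≤ (i + 1) * g i := by
    rw [div_mul_eq_mul_div, div_le_iff₀ (by positivity)] at h2
    linarith
  have h8 : i * (G ((i + 1 : ℕ) : ℝ) - G i) ≤ i * g (i + 1) :=
    mul_le_mul_of_nonneg_left h1 hi0.le
  have hGi := hG.nonneg i hi0.le
  rcases le_total 0 (g i) with hg | hg
  · nlinarith
  · nlinarith

/-- The weight `i min(1, i / N)`, which equals `i` for `i ≥ N` and tends to `0` as `N → ∞`. -/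
noncomputable def tailWeight (N i : ℕ) : ℝ := i * min 1 ((i : ℝ) / N)

lemma tailWeight_nonneg (N i : ℕ) : 0 ≤ tailWeight N i := by unfold tailWeight; positivity

lemma tailWeight_le (N i : ℕ) : tailWeight N i ≤ i :=
  mul_le_of_le_one_right (Nat.cast_nonneg _) (min_le_left _ _)

lemma tailWeight_eq {N i : ℕ} (hN : 1 ≤ N) (h : N ≤ i) : tailWeight N i = i := by
  have hN' : (0 : ℝ) < N := by exact_mod_cast hN
  rw [tailWeight, min_eq_left, mul_one]
  rw [le_div_iff₀ hN', one_mul]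
  exact_mod_cast h

/-- With `m = min 1 (i / N)`, the left side is at most `((i+1)^2 - i^2) m = (2 i + 1) m ≤ 3 i m`,
whatever `N` is. -/
lemma tailWeight_mul_sub_le (N : ℕ) {i : ℕ} (hi : 1 ≤ i) :
    i * (tailWeight N (i + 1) - tailWeight N i) ≤ 3 * tailWeight N i := by
  have hi1 : (1 : ℝ) ≤ i := by exact_mod_cast hi
  have hm0 : 0 ≤ min 1 ((i : ℝ) / N) := by positivity
  have hm : i * min 1 (((i : ℝ) + 1) / N) ≤ (i + 1) * min 1 ((i : ℝ) / N) := by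
    rw [mul_min_of_nonneg _ _ (by positivity), mul_min_of_nonneg _ _ (by positivity)]
    refine min_le_min (by linarith) (le_of_eq (by ring))
  unfold tailWeight
  push_cast
  nlinarith [mul_le_mul_of_nonneg_left hm (by linarith : (0 : ℝ) ≤ i + 1)]

lemma tendsto_tsum_tailWeight {x0 : ℕ → ℝ} (hx0 : Summable fun i : ℕ => (i : ℝ) * |x0 i|) :
    Tendsto (fun N => ∑' i, tailWeight N i * |x0 i|) atTop (𝓝 0) := by
  have h := tendsto_tsum_of_dominated_convergence (𝓕 := atTop)
    (f := fun N i => tailWeight N i * |x0 i|) (g := fun _ => 0) hx0 (fun i => ?_)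
    (Eventually.of_forall fun N i => ?_)
  · simpa using h
  · have h1 : Tendsto (fun N : ℕ => (i : ℝ) / N) atTop (𝓝 0) :=
      tendsto_const_div_atTop_nhds_zero_nat _
    have h2 := (((tendsto_const_nhds (x := (1 : ℝ))).min h1).const_mul (i : ℝ)).mul_const |x0 i|
    simpa [tailWeight] using h2
  · rw [Real.norm_of_nonneg (mul_nonneg (tailWeight_nonneg N i) (abs_nonneg _))]
    exact mul_le_mul_of_nonneg_right (tailWeight_le N i) (abs_nonneg _)

/-! ### Limits of series and compactness. -/

lemma abs_tsum_sub_sum_range_le {a : ℕ → ℝ} (ha : Summable a) {N : ℕ} {ε : ℝ}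
    (h : ∀ s : Finset ℕ, (∀ i ∈ s, N ≤ i) → |∑ i ∈ s, a i| ≤ ε) :
    |∑' i, a i - ∑ i ∈ Finset.range N, a i| ≤ ε := by
  have hl : Tendsto (fun s : Finset ℕ => |∑ i ∈ s, a i - ∑ i ∈ Finset.range N, a i|) atTop
      (𝓝 |∑' i, a i - ∑ i ∈ Finset.range N, a i|) := (ha.hasSum.sub_const _).abs
  refine le_of_tendsto hl ?_
  filter_upwards [eventually_ge_atTop (Finset.range N)] with s hs
  rw [← Finset.sum_sdiff hs, add_sub_cancel_right]
  exact h _ fun i hi => by simpa using (Finset.mem_sdiff.1 hi).2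

/-- Termwise convergence together with uniformly small tails allows to pass to the limit in a
series. -/
lemma summable_and_tendsto_tsum_of_tail {a : ℕ → ℕ → ℝ} {b : ℕ → ℝ}
    (ha : ∀ i, Tendsto (fun n => a n i) atTop (𝓝 (b i))) (hs : ∀ n, Summable (a n))
    (htail : ∀ ε > 0, ∃ N, ∀ᶠ n in atTop, ∀ s : Finset ℕ, (∀ i ∈ s, N ≤ i) →
      |∑ i ∈ s, a n i| ≤ ε) :
    Summable b ∧ Tendsto (fun n => ∑' i, a n i) atTop (𝓝 (∑' i, b i)) := by
  have hfin : ∀ s : Finset ℕ, Tendsto (fun n => ∑ i ∈ s, a n i) atTop (𝓝 (∑ i ∈ s, b i)) :=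
    fun s => tendsto_finsetSum s fun i _ => ha i
  have htail' : ∀ ε > 0, ∃ N, (∀ᶠ n in atTop, ∀ s : Finset ℕ, (∀ i ∈ s, N ≤ i) →
      |∑ i ∈ s, a n i| ≤ ε) ∧ ∀ s : Finset ℕ, (∀ i ∈ s, N ≤ i) → |∑ i ∈ s, b i| ≤ ε := by
    intro ε hε
    obtain ⟨N, hN⟩ := htail ε hε
    exact ⟨N, hN, fun s hsN => le_of_tendsto (hfin s).abs (hN.mono fun n hn => hn s hsN)⟩
  have hb : Summable b := by
    refine summable_iff_vanishing_norm.2 fun ε hε => ?_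
    obtain ⟨N, -, hN⟩ := htail' (ε / 2) (half_pos hε)
    refine ⟨Finset.range N, fun s hdis => (hN s fun i hi => ?_).trans_lt (half_lt_self hε)⟩
    simpa using Finset.disjoint_left.1 hdis hi
  refine ⟨hb, Metric.tendsto_atTop'.2 fun ε hε => ?_⟩
  obtain ⟨N, hN, hNb⟩ := htail' (ε / 4) (by positivity)
  have hclose := Metric.tendsto_nhds.1 (hfin (Finset.range N)) (ε / 4) (by positivity)
  obtain ⟨n₀, hn₀⟩ := eventually_atTop.1 (hN.and hclose)
  refine ⟨n₀, fun n hn => ?_⟩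
  obtain ⟨h1, h2⟩ := hn₀ n hn.le
  have h3 := abs_tsum_sub_sum_range_le (hs n) h1
  have h4 := abs_tsum_sub_sum_range_le hb hNb
  rw [Real.dist_eq] at h2 ⊢
  rw [abs_le] at h3 h4
  rw [abs_lt] at h2 ⊢
  constructor <;> linarith

/-- Bounded functions with uniform Lipschitz constants have a pointwise convergent subsequence. -/
lemma exists_subseq_tendsto_of_lipschitzWith {f : ℕ → ℕ → ℝ → ℝ} {M : ℝ} {C : ℕ → NNReal}
    (hM : ∀ n i t, f n i t ∈ Icc 0 M) (hC : ∀ n i, LipschitzWith (C i) (f n i)) :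
    ∃ ψ : ℕ → ℕ, StrictMono ψ ∧ ∃ g : ℕ → ℝ → ℝ,
      ∀ i t, Tendsto (fun k => f (ψ k) i t) atTop (𝓝 (g i t)) := by
  -- Tychonoff over sizes and rational times replaces a diagonal extraction; the Lipschitz bounds
  -- then give convergence at every real time.
  have hcomp : IsCompact (Set.pi univ fun _ : ℕ × ℚ => Icc (0 : ℝ) M) :=
    isCompact_univ_pi fun _ => isCompact_Icc
  obtain ⟨a, -, ψ, hψ, ha⟩ := hcomp.tendsto_subseq
    (x := fun n (p : ℕ × ℚ) => f n p.1 (p.2 : ℝ)) (fun n p _ => hM n p.1 p.2)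
  rw [tendsto_pi_nhds] at ha
  refine ⟨ψ, hψ, ?_⟩
  have hlim : ∀ i t, ∃ l, Tendsto (fun k => f (ψ k) i t) atTop (𝓝 l) := by
    intro i t
    refine cauchySeq_tendsto_of_complete (Metric.cauchySeq_iff'.2 fun ε hε => ?_)
    have hδ : 0 < ε / (4 * (C i + 1)) := by positivity
    obtain ⟨q, hq1, hq2⟩ := exists_rat_btwn (lt_add_of_pos_right t hδ)
    have hdist : ∀ k, dist (f (ψ k) i t) (f (ψ k) i q) ≤ ε / 4 := by
      intro k
      refine ((hC (ψ k) i).dist_le_mul t q).trans ?_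
      have h1 : dist t (q : ℝ) ≤ ε / (4 * (C i + 1)) := by
        rw [Real.dist_eq, abs_le]; constructor <;> linarith
      have hC0 : (0 : ℝ) ≤ C i := (C i).2
      calc (C i : ℝ) * dist t q ≤ (C i + 1) * (ε / (4 * (C i + 1))) := by
            refine mul_le_mul (by linarith) h1 dist_nonneg (by positivity)
        _ = ε / 4 := by field_simp
    obtain ⟨k₀, hk₀⟩ := Metric.cauchySeq_iff'.1 (ha (i, q)).cauchySeq (ε / 4) (by positivity)
    refine ⟨k₀, fun k hk => ?_⟩
    have h1 := hdist k
    have h2 := hdist k₀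
    have h3 := hk₀ k hk
    simp only [Function.comp_apply] at h3
    rw [dist_comm] at h2
    calc dist (f (ψ k) i t) (f (ψ k₀) i t)
        ≤ dist (f (ψ k) i t) (f (ψ k) i q) + dist (f (ψ k) i q) (f (ψ k₀) i q) +
          dist (f (ψ k₀) i q) (f (ψ k₀) i t) := dist_triangle4 _ _ _ _
      _ < ε := by linarith
  choose g hg using hlim
  exact ⟨g, hg⟩

/-- Truncated solutions extend to bounded functions on `ℝ` that are Lipschitz continuous uniformly
in the truncation. -/
lemma IsTruncSolution.exists_extension {κ : ℕ → ℕ → ℝ} {n : ℕ} {A : ℝ} (hA : 0 ≤ A)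
    (hκ : IsTruncKernel κ n A) {x0 : ℕ → ℝ} {T : ℝ} (hT : 0 ≤ T) {x : ℕ → ℝ → ℝ}
    (hx : IsTruncSolution κ n x0 T x) {M : ℝ}
    (hM : ∑ i ∈ Finset.range (n + 1), (i : ℝ) * x0 i ≤ M) (hM0 : 0 ≤ M) :
    ∃ z, IsTruncSolution κ n x0 T z ∧ (∀ i t, z i t ∈ Icc 0 M) ∧
      ∀ i : ℕ, LipschitzWith (2 * A * (i + 1) * M ^ 2).toNNReal (z i) := by
  have hz : ∀ i, ∀ t ∈ Icc 0 T, x i (projIcc 0 T hT t) = x i t := by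
    intro i t ht
    rw [projIcc_of_mem hT ht]
  -- Freezing the solution outside `[0, T]` keeps the bounds and the Lipschitz constants.
  refine ⟨fun i t => x i (projIcc 0 T hT t), ?_, ?_, ?_⟩
  · refine ⟨fun i => ?_, fun i hi t => hx.eq_zero i hi _, fun i t _ => hx.nonneg i _ (projIcc ..).2,
      fun t _ => hx.mass _ (projIcc ..).2, fun t _ => hx.zero_eq _ (projIcc ..).2,
      fun i hi t ht => ?_⟩
    · rw [hz i 0 ⟨le_rfl, hT⟩, hx.init]
    · simp_rw [hz _ t ht]
      exact (hx.deriv i hi t ht).congr (fun s hs => hz i s hs) (hz i t ht)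
  · exact fun i t => ⟨hx.nonneg i _ (projIcc ..).2, hx.le_mass hM hM0 i (projIcc ..).2⟩
  · intro i
    have hlip : LipschitzOnWith (2 * A * (i + 1) * M ^ 2).toNNReal (x i) (Icc 0 T) := by
      by_cases hi : i ≤ n
      · refine (convex_Icc 0 T).lipschitzOnWith_of_nnnorm_hasDerivWithin_le (hx.deriv i hi) ?_
        intro t ht
        rw [← NNReal.coe_le_coe, coe_nnnorm, Real.coe_toNNReal _ (by positivity)]
        exact hκ.abs_truncRHS_le hA (fun j => hx.nonneg j t ht) ((hx.mass t ht).le.trans hM)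
          (fun j => hx.le_mass hM hM0 j ht) hi
      · have h0 : x i = fun _ => 0 := funext fun t => hx.eq_zero i (by omega) t
        rw [h0]
        exact ((LipschitzWith.const (0 : ℝ)).weaken zero_le).lipschitzOnWith
    have h := hlip.to_restrict.comp (LipschitzWith.projIcc hT)
    rw [mul_one] at h
    exact h

/-! ### Passage to the limit. -/

/-- A sequence `y` of solutions of the equation truncated at the sizes `ψ k` that converges
pointwise to `ξ`. -/
structure IsApproximation (γ : ℕ → ℕ → ℝ) (A : ℝ) (x0 : ℕ → ℝ) (ψ : ℕ → ℕ)
    (y : ℕ → ℕ → ℝ → ℝ) (ξ : ℕ → ℝ → ℝ) : Prop where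
  strictMono : StrictMono ψ
  kernel : ∀ k, IsTruncKernel (truncKernel γ (ψ k)) (ψ k) A
  sol : ∀ k, IsTruncSolution (truncKernel γ (ψ k)) (ψ k) x0 (ψ k) (y k)
  mem_Icc : ∀ k i t, y k i t ∈ Icc 0 (normXiOne x0)
  lipschitz : ∀ k i,
    LipschitzWith (2 * A * ((i : ℝ) + 1) * normXiOne x0 ^ 2).toNNReal (y k i)
  lim : ∀ i t, Tendsto (fun k => y k i t) atTop (𝓝 (ξ i t))

lemma MemXiOnePos.sum_le {x0 : ℕ → ℝ} (hx0 : MemXiOnePos x0) (n : ℕ) :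
    ∑ i ∈ Finset.range n, (i : ℝ) * x0 i ≤ normXiOne x0 :=
  (Finset.sum_le_sum fun _ _ => mul_le_mul_of_nonneg_left (le_abs_self _) (Nat.cast_nonneg _)).trans
    (hx0.1.sum_le_tsum _ fun _ _ => mul_nonneg (Nat.cast_nonneg _) (abs_nonneg _))

lemma normXiOne_nonneg (x : ℕ → ℝ) : 0 ≤ normXiOne x :=
  tsum_nonneg fun _ => mul_nonneg (Nat.cast_nonneg _) (abs_nonneg _)

/-- The `n`-th problem is solved on `[0, n]`, so a single subsequence serves all times. -/
lemma exists_isApproximation {γ : ℕ → ℕ → ℝ} {A : ℝ} (hA : 0 < A)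
    (hγ_nonneg : ∀ i j : ℕ, 1 ≤ i → 1 ≤ j → 0 ≤ γ i j)
    (hγ_symm : ∀ i j : ℕ, 1 ≤ i → 1 ≤ j → γ i j = γ j i)
    (hγ_growth : ∀ i j : ℕ, 1 ≤ i → 1 ≤ j → γ i j ≤ A * ((i : ℝ) + (j : ℝ)))
    {x0 : ℕ → ℝ} (hx0 : MemXiOnePos x0) : ∃ ψ y ξ, IsApproximation γ A x0 ψ y ξ := by
  have hκ := isTruncKernel_truncKernel hA hγ_nonneg hγ_symm hγ_growth
  have hex : ∀ n : ℕ, ∃ z, IsTruncSolution (truncKernel γ n) n x0 n z ∧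
      (∀ i t, z i t ∈ Icc 0 (normXiOne x0)) ∧
      ∀ i : ℕ, LipschitzWith (2 * A * (i + 1) * normXiOne x0 ^ 2).toNNReal (z i) := by
    intro n
    obtain ⟨x, hx⟩ := (hκ n).exists_isTruncSolution hx0.2 (Nat.cast_nonneg n)
    exact hx.exists_extension hA.le (hκ n) (Nat.cast_nonneg n) (hx0.sum_le _) (normXiOne_nonneg x0)
  choose z hz hzM hzL using hex
  obtain ⟨ψ, hψ, ξ, hξ⟩ := exists_subseq_tendsto_of_lipschitzWith hzM hzL
  exact ⟨ψ, fun k => z (ψ k), ξ, hψ, fun k => hκ _, fun k => hz _, fun k => hzM _,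
    fun k => hzL _, hξ⟩

lemma sum_le_sum_range_of_eq_zero {f : ℕ → ℝ} (hf : ∀ i, 0 ≤ f i) {n : ℕ}
    (hn : ∀ i, n < i → f i = 0) (s : Finset ℕ) :
    ∑ i ∈ s, f i ≤ ∑ i ∈ Finset.range (n + 1), f i := by
  rw [Finset.sum_subset (Finset.subset_union_right (s₁ := s) (s₂ := Finset.range (n + 1)))
    fun i _ hi => hn i (by rw [Finset.mem_range] at hi; omega)]
  exact Finset.sum_le_sum_of_subset_of_nonneg Finset.subset_union_left fun i _ _ => hf i

namespace IsApproximation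

variable {γ : ℕ → ℕ → ℝ} {A : ℝ} {x0 : ℕ → ℝ} {ψ : ℕ → ℕ} {y : ℕ → ℕ → ℝ → ℝ} {ξ : ℕ → ℝ → ℝ}

lemma eventually_mem_Icc (h : IsApproximation γ A x0 ψ y ξ) {t : ℝ} (ht : 0 ≤ t) :
    ∀ᶠ k in atTop, t ∈ Icc 0 (ψ k : ℝ) := by
  filter_upwards [(tendsto_natCast_atTop_atTop.comp h.strictMono.tendsto_atTop).eventually_ge_atTop
    t] with k hk
  exact ⟨ht, hk⟩

lemma eventually_lt (h : IsApproximation γ A x0 ψ y ξ) (i : ℕ) : ∀ᶠ k in atTop, i < ψ k :=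
  h.strictMono.tendsto_atTop.eventually_gt_atTop i

lemma nonneg (h : IsApproximation γ A x0 ψ y ξ) (i : ℕ) (t : ℝ) : 0 ≤ ξ i t :=
  ge_of_tendsto' (h.lim i t) fun k => (h.mem_Icc k i t).1

lemma continuous_approx (h : IsApproximation γ A x0 ψ y ξ) (k i : ℕ) : Continuous (y k i) :=
  (h.lipschitz k i).continuous

lemma continuous (h : IsApproximation γ A x0 ψ y ξ) (i : ℕ) : Continuous (ξ i) := by
  refine (LipschitzWith.of_dist_le_mul fun s t => ?_ :
    LipschitzWith (2 * A * ((i : ℝ) + 1) * normXiOne x0 ^ 2).toNNReal (ξ i)).continuous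
  exact le_of_tendsto' ((h.lim i s).dist (h.lim i t)) fun k => (h.lipschitz k i).dist_le_mul s t

lemma init_le (h : IsApproximation γ A x0 ψ y ξ) (k i : ℕ) : y k i 0 ≤ |x0 i| := by
  rw [(h.sol k).init]
  split_ifs
  · exact le_abs_self _
  · exact abs_nonneg _

lemma moment_le (h : IsApproximation γ A x0 ψ y ξ) (hA : 0 ≤ A) (hx0 : MemXiOnePos x0)
    {φ : ℕ → ℝ} {C : ℝ} (hC : 0 ≤ C) (hφ : ∀ i, 0 ≤ φ i)
    (hφC : ∀ i : ℕ, 1 ≤ i → i * (φ (i + 1) - φ i) ≤ C * φ i)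
    (hφx0 : Summable fun i => φ i * |x0 i|) {k : ℕ} {t : ℝ} (ht : t ∈ Icc 0 (ψ k : ℝ))
    (s : Finset ℕ) :
    ∑ i ∈ s, φ i * y k i t ≤
      Real.exp (2 * A * C * normXiOne x0 * t) * ∑' i, φ i * |x0 i| := by
  have h1 := (h.sol k).moment_le hA (h.kernel k) (hx0.sum_le _) hC hφ hφC ht
  refine (sum_le_sum_range_of_eq_zero (fun i => mul_nonneg (hφ i) (h.mem_Icc k i t).1)
    (fun i hi => ?_) s).trans (h1.trans (mul_le_mul_of_nonneg_left ?_ (Real.exp_pos _).le))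
  · rw [(h.sol k).eq_zero i hi, mul_zero]
  · exact (Finset.sum_le_sum fun i _ => mul_le_mul_of_nonneg_left (h.init_le k i) (hφ i)).trans
      (hφx0.sum_le_tsum _ fun i _ => mul_nonneg (hφ i) (abs_nonneg _))

lemma moment_limit_le (h : IsApproximation γ A x0 ψ y ξ) (hA : 0 ≤ A) (hx0 : MemXiOnePos x0)
    {φ : ℕ → ℝ} {C : ℝ} (hC : 0 ≤ C) (hφ : ∀ i, 0 ≤ φ i)
    (hφC : ∀ i : ℕ, 1 ≤ i → i * (φ (i + 1) - φ i) ≤ C * φ i)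
    (hφx0 : Summable fun i => φ i * |x0 i|) {t : ℝ} (ht : 0 ≤ t) (s : Finset ℕ) :
    ∑ i ∈ s, φ i * ξ i t ≤ Real.exp (2 * A * C * normXiOne x0 * t) * ∑' i, φ i * |x0 i| :=
  le_of_tendsto (tendsto_finsetSum s fun i _ => (h.lim i t).const_mul (φ i))
    ((h.eventually_mem_Icc ht).mono fun _ hk => h.moment_le hA hx0 hC hφ hφC hφx0 hk s)

/-- The tails of the first moment are uniformly small. -/
lemma tail_le (h : IsApproximation γ A x0 ψ y ξ) (hA : 0 ≤ A) (hx0 : MemXiOnePos x0) {t : ℝ}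
    (ht : 0 ≤ t) {ε : ℝ} (hε : 0 < ε) :
    ∃ N, ∀ᶠ k in atTop, ∀ s : Finset ℕ, (∀ i ∈ s, N ≤ i) → ∑ i ∈ s, (i : ℝ) * y k i t ≤ ε := by
  have hlim := (tendsto_tsum_tailWeight hx0.1).const_mul (Real.exp (2 * A * 3 * normXiOne x0 * t))
  rw [mul_zero] at hlim
  obtain ⟨N, hN, hN1⟩ := ((hlim.eventually_lt_const hε).and (eventually_ge_atTop 1)).exists
  refine ⟨N, (h.eventually_mem_Icc ht).mono fun k hk s hs => ?_⟩
  have hsum : Summable fun i => tailWeight N i * |x0 i| :=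
    hx0.1.of_nonneg_of_le (fun i => mul_nonneg (tailWeight_nonneg N i) (abs_nonneg _))
      fun i => mul_le_mul_of_nonneg_right (tailWeight_le N i) (abs_nonneg _)
  have := h.moment_le hA hx0 (by norm_num) (tailWeight_nonneg N)
    (fun i hi => tailWeight_mul_sub_le N hi) hsum hk s
  rw [Finset.sum_congr rfl fun i hi => by rw [tailWeight_eq hN1 (hs i hi)]] at this
  exact this.trans hN.le

/-- Uniformly small tails let no mass escape to infinity, while the approximate masses are partial
sums of the initial mass. -/
lemma summable_and_mass_eq (h : IsApproximation γ A x0 ψ y ξ) (hA : 0 ≤ A)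
    (hx0 : MemXiOnePos x0) {t : ℝ} (ht : 0 ≤ t) :
    MemXiOne (fun i => ξ i t) ∧ normXiOne (fun i => ξ i t) = normXiOne x0 := by
  have hvan : ∀ k, ∀ i ∉ Finset.range (ψ k + 1), (i : ℝ) * y k i t = 0 := by
    intro k i hi
    rw [(h.sol k).eq_zero i (by rw [Finset.mem_range] at hi; omega), mul_zero]
  obtain ⟨hs, hl⟩ := summable_and_tendsto_tsum_of_tail (a := fun k i => (i : ℝ) * y k i t)
    (b := fun i => (i : ℝ) * ξ i t) (fun i => (h.lim i t).const_mul _)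
    (fun k => summable_of_ne_finset_zero (hvan k)) (fun ε hε => by
      obtain ⟨N, hN⟩ := h.tail_le hA hx0 ht hε
      refine ⟨N, hN.mono fun k hk s hsN => ?_⟩
      rw [abs_of_nonneg (Finset.sum_nonneg fun i _ =>
        mul_nonneg (Nat.cast_nonneg _) (h.mem_Icc k i t).1)]
      exact hk s hsN)
  have habs : ∀ i : ℕ, (i : ℝ) * |ξ i t| = i * ξ i t := fun i => by rw [abs_of_nonneg (h.nonneg i t)]
  have habs0 : ∀ i : ℕ, (i : ℝ) * |x0 i| = i * x0 i := fun i => by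
    rcases Nat.eq_zero_or_pos i with rfl | hi
    · simp
    · rw [abs_of_nonneg (hx0.2 i hi)]
  refine ⟨by simpa only [MemXiOne, habs] using hs, ?_⟩
  have hx0s : Summable fun i : ℕ => (i : ℝ) * x0 i := by
    simpa only [MemXiOne, habs0] using hx0.1
  have hl' := (hx0s.hasSum.tendsto_sum_nat.comp (tendsto_add_atTop_nat 1)).comp
    h.strictMono.tendsto_atTop
  simp only [normXiOne, habs, habs0]
  refine tendsto_nhds_unique hl (hl'.congr' ?_)
  filter_upwards [h.eventually_mem_Icc ht] with k hk
  rw [tsum_eq_sum (hvan k), (h.sol k).mass t hk]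
  rfl

lemma truncKernel_eventuallyEq (h : IsApproximation γ A x0 ψ y ξ) {i j : ℕ} (hi : 1 ≤ i)
    (hj : 1 ≤ j) : ∀ᶠ k in atTop, truncKernel γ (ψ k) i j = γ i j := by
  filter_upwards [h.eventually_lt i, h.eventually_lt j] with k h1 h2
  exact if_pos ⟨hi, h1, hj, h2⟩

lemma tendsto_growthRate (h : IsApproximation γ A x0 ψ y ξ) (i : ℕ) (t : ℝ) :
    Tendsto (fun k => growthRate (truncKernel γ (ψ k)) (fun n => y k n t) i) atTop
      (𝓝 (growthRate γ (fun n => ξ n t) i)) := by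
  refine (h.lim i t).mul (tendsto_finsetSum _ fun j hj => Tendsto.mul ?_ (h.lim j t))
  obtain ⟨hj1, hji⟩ := Finset.mem_Icc.1 hj
  refine tendsto_const_nhds.congr' ?_
  filter_upwards [h.truncKernel_eventuallyEq (hj1.trans hji) hj1] with k hk
  rw [hk]

/-- Convergence of the truncated loss terms. -/
lemma summable_and_tendsto_loss (h : IsApproximation γ A x0 ψ y ξ) (hA : 0 ≤ A)
    (hx0 : MemXiOnePos x0) {i : ℕ} (hi : 1 ≤ i) {t : ℝ} (ht : 0 ≤ t) :
    (Summable fun m : ℕ => γ i (i + m) * ξ i t * ξ (i + m) t) ∧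
      Tendsto (fun k => ∑ j ∈ Finset.Icc i (ψ k), truncKernel γ (ψ k) i j * y k i t * y k j t)
        atTop (𝓝 (lossSeries γ (fun n => ξ n t) i)) := by
  set M := normXiOne x0
  have hM : 0 ≤ M := normXiOne_nonneg x0
  set a : ℕ → ℕ → ℝ := fun k m => truncKernel γ (ψ k) i (i + m) * y k i t * y k (i + m) t with ha
  have ha0 : ∀ k m, 0 ≤ a k m := fun k m =>
    mul_nonneg (mul_nonneg ((h.kernel k).nonneg _ _) (h.mem_Icc k _ t).1) (h.mem_Icc k _ t).1
  have hvan : ∀ k, ∀ m ∉ Finset.range (ψ k + 1 - i), a k m = 0 := by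
    intro k m hm
    simp only [ha]
    rw [(h.sol k).eq_zero (i + m) (by rw [Finset.mem_range] at hm; omega), mul_zero]
  have hle : ∀ k m, a k m ≤ 2 * A * M * (((i + m : ℕ) : ℝ) * y k (i + m) t) := by
    intro k m
    have h1 := (h.kernel k).le i (i + m)
    have h2 := h.mem_Icc k i t
    have h3 := (h.mem_Icc k (i + m) t).1
    have h4 : truncKernel γ (ψ k) i (i + m) ≤ 2 * A * ((i + m : ℕ) : ℝ) := by
      refine h1.trans ?_
      have : (i : ℝ) ≤ ((i + m : ℕ) : ℝ) := by exact_mod_cast Nat.le_add_right i m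
      nlinarith
    calc a k m ≤ 2 * A * ((i + m : ℕ) : ℝ) * M * y k (i + m) t :=
          mul_le_mul_of_nonneg_right (mul_le_mul h4 h2.2 h2.1 (by positivity)) h3
      _ = _ := by ring
  obtain ⟨hs, hl⟩ := summable_and_tendsto_tsum_of_tail (a := a)
    (b := fun m => γ i (i + m) * ξ i t * ξ (i + m) t) (fun m => by
      refine (Tendsto.mul ?_ (h.lim i t)).mul (h.lim (i + m) t)
      refine tendsto_const_nhds.congr' ?_
      filter_upwards [h.truncKernel_eventuallyEq hi (hi.trans (Nat.le_add_right i m))] with k hk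
      rw [hk])
    (fun k => summable_of_ne_finset_zero (hvan k)) (fun ε hε => by
      -- The `+ 1` keeps the quotient meaningful when the mass is zero.
      have hε' : 0 < ε / (2 * A * M + 1) := by positivity
      obtain ⟨N, hN⟩ := h.tail_le hA hx0 ht hε'
      refine ⟨N, hN.mono fun k hk s hsN => ?_⟩
      rw [abs_of_nonneg (Finset.sum_nonneg fun m _ => ha0 k m)]
      have h1 := hk (s.map (addLeftEmbedding i)) fun j hj => by
        obtain ⟨m, hm, rfl⟩ := Finset.mem_map.1 hj
        exact (hsN m hm).trans (Nat.le_add_left m i)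
      rw [Finset.sum_map] at h1
      simp only [addLeftEmbedding_apply] at h1
      refine (Finset.sum_le_sum fun m _ => hle k m).trans ?_
      rw [← Finset.mul_sum]
      calc 2 * A * M * ∑ m ∈ s, ((i + m : ℕ) : ℝ) * y k (i + m) t
          ≤ (2 * A * M + 1) * (ε / (2 * A * M + 1)) :=
            mul_le_mul (by linarith) h1 (Finset.sum_nonneg fun m _ =>
              mul_nonneg (Nat.cast_nonneg _) (h.mem_Icc k _ t).1) (by positivity)
        _ = ε := by field_simp)
  refine ⟨hs, hl.congr fun k => ?_⟩
  rw [tsum_eq_sum (hvan k), ← Finset.Ico_add_one_right_eq_Icc, Finset.sum_Ico_eq_sum_range]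

lemma tendsto_truncRHS (h : IsApproximation γ A x0 ψ y ξ) (hA : 0 ≤ A)
    (hx0 : MemXiOnePos x0) {i : ℕ} (hi : 1 ≤ i) {t : ℝ} (ht : 0 ≤ t) :
    Tendsto (fun k => truncRHS (truncKernel γ (ψ k)) (ψ k) (fun n => y k n t) i) atTop
      (𝓝 (safronovRHS γ (fun n => ξ n t) i)) :=
  ((h.tendsto_growthRate (i - 1) t).sub (h.tendsto_growthRate i t)).sub
    (h.summable_and_tendsto_loss hA hx0 hi ht).2

/-- The loss is a pointwise limit of continuous functions eventually bounded by `2 A M^2`, with `M`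
the initial mass. -/
lemma integrableOn_lossSeries (h : IsApproximation γ A x0 ψ y ξ) (hA : 0 ≤ A)
    (hx0 : MemXiOnePos x0) {i : ℕ} (hi : 1 ≤ i) (t : ℝ) :
    IntegrableOn (fun s => lossSeries γ (fun n => ξ n s) i) (Ioo 0 t) := by
  have hlim : ∀ s ∈ Ioo 0 t, Tendsto
      (fun k => ∑ j ∈ Finset.Icc i (ψ k), truncKernel γ (ψ k) i j * y k i s * y k j s)
        atTop (𝓝 (lossSeries γ (fun n => ξ n s) i)) := fun s hs =>
    (h.summable_and_tendsto_loss hA hx0 hi hs.1.le).2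
  have hcont := h.continuous_approx
  refine IntegrableOn.of_bound (by simp) ?_ (2 * A * normXiOne x0 ^ 2) ?_
  · refine aestronglyMeasurable_of_tendsto_ae (μ := volume.restrict (Ioo 0 t)) atTop (f := fun k s =>
      ∑ j ∈ Finset.Icc i (ψ k), truncKernel γ (ψ k) i j * y k i s * y k j s) (fun k => ?_) ?_
    · exact Continuous.aestronglyMeasurable (by fun_prop)
    · exact (ae_restrict_iff' measurableSet_Ioo).2 (Eventually.of_forall hlim)
  · refine (ae_restrict_iff' measurableSet_Ioo).2 (Eventually.of_forall fun s hs => ?_)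
    refine le_of_tendsto (hlim s hs).norm ?_
    filter_upwards [h.eventually_mem_Icc hs.1.le] with k hk
    have hy := fun j => (h.mem_Icc k j s).1
    rw [Real.norm_of_nonneg ((h.kernel k).loss_nonneg hy i)]
    exact (h.kernel k).loss_le hA hy (((h.sol k).mass s hk).le.trans (hx0.sum_le _))
      (fun j => (h.mem_Icc k j s).2) i

/-- Dominated convergence in the integrated truncated equation, with the constant bound of
`abs_truncRHS_le`. -/
lemma integral_equation (h : IsApproximation γ A x0 ψ y ξ) (hA : 0 ≤ A)
    (hx0 : MemXiOnePos x0) {i : ℕ} (hi : 1 ≤ i) {t : ℝ} (ht : 0 ≤ t) :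
    ξ i t = x0 i + ∫ s in (0 : ℝ)..t, safronovRHS γ (fun n => ξ n s) i := by
  have hcont := h.continuous_approx
  have hcontRHS : ∀ k, Continuous fun s =>
      truncRHS (truncKernel γ (ψ k)) (ψ k) (fun n => y k n s) i := by
    intro k
    unfold truncRHS growthRate
    fun_prop
  have heq : ∀ᶠ k in atTop, y k i t =
      x0 i + ∫ s in (0 : ℝ)..t, truncRHS (truncKernel γ (ψ k)) (ψ k) (fun n => y k n s) i := by
    filter_upwards [h.eventually_mem_Icc ht, h.eventually_lt i] with k hk hik
    have hFTC := intervalIntegral.integral_eq_sub_of_hasDerivAt_of_le ht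
      (f := y k i) (f' := fun s => truncRHS (truncKernel γ (ψ k)) (ψ k) (fun n => y k n s) i)
      (hcont k i).continuousOn (fun s hs => ((h.sol k).deriv i hik.le s
        ⟨hs.1.le, hs.2.le.trans hk.2⟩).hasDerivAt (Icc_mem_nhds hs.1 (hs.2.trans_le hk.2)))
      ((hcontRHS k).intervalIntegrable _ _)
    rw [hFTC, (h.sol k).init, if_pos ⟨hi, hik.le⟩]
    ring
  have hint : Tendsto
      (fun k => ∫ s in (0 : ℝ)..t, truncRHS (truncKernel γ (ψ k)) (ψ k) (fun n => y k n s) i)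
      atTop (𝓝 (∫ s in (0 : ℝ)..t, safronovRHS γ (fun n => ξ n s) i)) := by
    refine intervalIntegral.tendsto_integral_filter_of_dominated_convergence
      (fun _ => 2 * A * (i + 1) * normXiOne x0 ^ 2)
      (Eventually.of_forall fun k => (hcontRHS k).aestronglyMeasurable) ?_
      intervalIntegrable_const ?_
    · filter_upwards [h.eventually_mem_Icc ht, h.eventually_lt i] with k hk hik
      refine Eventually.of_forall fun s hs => ?_
      rw [uIoc_of_le ht] at hs
      exact (h.kernel k).abs_truncRHS_le hA (fun j => (h.mem_Icc k j s).1)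
        (((h.sol k).mass s ⟨hs.1.le, hs.2.trans hk.2⟩).le.trans (hx0.sum_le _))
        (fun j => (h.mem_Icc k j s).2) hik.le
    · refine Eventually.of_forall fun s hs => ?_
      rw [uIoc_of_le ht] at hs
      exact h.tendsto_truncRHS hA hx0 hi hs.1.le
  exact tendsto_nhds_unique (h.lim i t)
    ((hint.const_add (x0 i)).congr' (heq.mono fun k hk => hk.symm))

lemma isSafronovSolution (h : IsApproximation γ A x0 ψ y ξ) (hA : 0 ≤ A)
    (hx0 : MemXiOnePos x0) : IsSafronovSolution γ x0 ξ where
  nonneg i _ t _ := h.nonneg i t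
  continuousOn i _ := (h.continuous i).continuousOn
  summable _ hi _ _ := (ae_restrict_iff' measurableSet_Ioo).2 (Eventually.of_forall fun _ hs =>
    (h.summable_and_tendsto_loss hA hx0 hi hs.1.le).1)
  integrable _ hi t _ := h.integrableOn_lossSeries hA hx0 hi t
  equation _ hi _ ht := h.integral_equation hA hx0 hi ht

end IsApproximation

theorem mainTheorem4
    (γ : ℕ → ℕ → ℝ) (A : ℝ) (hA : 0 < A)
    (hγ_nonneg : ∀ i j : ℕ, 1 ≤ i → 1 ≤ j → 0 ≤ γ i j)
    (hγ_symm : ∀ i j : ℕ, 1 ≤ i → 1 ≤ j → γ i j = γ j i)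
    (hγ_growth : ∀ i j : ℕ, 1 ≤ i → 1 ≤ j → γ i j ≤ A * ((i : ℝ) + (j : ℝ)))
    (x0 : ℕ → ℝ) (hx0 : MemXiOnePos x0)
    (G : ℝ → ℝ) (hG : MemGOne G)
    (hGx0 : Summable fun i : ℕ => G (i : ℝ) * x0 i) :
    ∃ ξ : ℕ → ℝ → ℝ, IsSafronovSolution γ x0 ξ ∧
      (∀ t : ℝ, 0 ≤ t →
        MemXiOne (fun i => ξ i t) ∧ normXiOne (fun i => ξ i t) = normXiOne x0) ∧
      (∀ T : ℝ, 0 < T →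
        (∀ t ∈ Set.Icc (0 : ℝ) T, Summable fun i : ℕ => G (i : ℝ) * ξ i t) ∧
        BddAbove ((fun t : ℝ => ∑' i : ℕ, G (i : ℝ) * ξ i t) '' Set.Icc (0 : ℝ) T)) := by
  obtain ⟨ψ, y, ξ, h⟩ := exists_isApproximation hA hγ_nonneg hγ_symm hγ_growth hx0
  have hG0 : ∀ i : ℕ, 0 ≤ G i := fun i => hG.nonneg i (Nat.cast_nonneg i)
  -- The sign of `x0 0` is unknown, but `G 0 = 0` removes that term.
  have hGabs : Summable fun i : ℕ => G i * |x0 i| := by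
    refine hGx0.congr fun i => ?_
    rcases Nat.eq_zero_or_pos i with rfl | hi
    · simp [hG.zero]
    · rw [abs_of_nonneg (hx0.2 i hi)]
  have hbound : ∀ t, 0 ≤ t → ∀ s : Finset ℕ, ∑ i ∈ s, G i * ξ i t ≤
      Real.exp (2 * A * 8 * normXiOne x0 * t) * ∑' i : ℕ, G i * |x0 i| := fun t ht s =>
    h.moment_limit_le hA.le hx0 (φ := fun i => G i) (by norm_num) hG0
      (fun i hi => hG.mul_sub_le hi) hGabs ht s
  have hsum : ∀ t, 0 ≤ t → Summable fun i : ℕ => G i * ξ i t := fun t ht =>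
    summable_of_sum_le (fun i => mul_nonneg (hG0 i) (h.nonneg i t)) (hbound t ht)
  refine ⟨ξ, h.isSafronovSolution hA.le hx0, fun t ht => h.summable_and_mass_eq hA.le hx0 ht,
    fun T _ => ⟨fun t ht => hsum t ht.1,
      Real.exp (2 * A * 8 * normXiOne x0 * T) * ∑' i : ℕ, G i * |x0 i|, ?_⟩⟩
  rintro _ ⟨t, ht, rfl⟩
  refine ((hsum t ht.1).tsum_le_of_sum_le (hbound t ht.1)).trans ?_
  have hM := normXiOne_nonneg x0
  refine mul_le_mul_of_nonneg_right (Real.exp_le_exp.2 ?_)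
    (tsum_nonneg fun i => mul_nonneg (hG0 i) (abs_nonneg _))
  exact mul_le_mul_of_nonneg_left ht.2 (by positivity)
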